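/- Let $d=2^n$. A \emph{local measurement} on $n$ qubits is a POVM with finitely many outcomes whose elements have the form $w_i\,d\,|v_i\rangle\langle v_i|$, where $w_i\ge 0$, $|v_i\rangle=|v_i^{(1)}\rangle\otimes\cdots\otimes|v_i^{(n)}\rangle$ is a tensor product of single-qubit unit vectors, and $\sum_i w_i\,d\,|v_i\rangle\langle v_i|=\mathbb I$ (so that $\sum_i w_i=1$). An operator is \emph{$k$-local} if it acts nontrivially on at most $k$ of the $n$ qubits. For every $p>1/2$ there is a constant $c>0$, depending only on $p$, such that the following holds for all integers $n,k,M,N\ge 0$ with $M\le 3^k\binom nk$ and all $0<\epsilon<1/2$ (with the convention $\log 0=0$). Fix a sequence of local measurements $F_1,\ldots,F_N$ on $n$ qubits. Suppose that for any $M$ $k$-local observables $-\mathbb I\preceq O_1,\ldots,O_M\preceq\mathbb I$ there is a machine (an arbitrary, possibly randomized, map from measurement outcomes to $\mathbb R^M$) with the following property: for every $n$-qubit state $\rho$, when $F_1,\ldots,F_N$ are performed on $N$ copies of $\rho$, with $F_j$ measuring the $j$-th copy, the machine turns the outcomes into predictions $\hat o_1,\ldots,\hat o_M$ such that, with probability at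 least $p$, $|\hat o_i-\operatorname{Tr}(O_i\rho)|\le\epsilon$ for all $1\le i\le M$. Then $$N\;\ge\;c\,\frac{3^k\log M}{\epsilon^2}.$$ In other words, for any fixed success probability above $1/2$, necessarily $N=\Omega\bigl(3^k\log(M)/\epsilon^2\bigr)$. -/

import Mathlib

open Matrix
open scoped ComplexOrder

/-- Operators on `n` qubits, as matrices in the computational basis. A basis vector is labelled by
a bit string `Fin n → Fin 2`, so the dimension is `2 ^ n`. -/
abbrev QubitOp (n : ℕ) : Type := Matrix (Fin n → Fin 2) (Fin n → Fin 2) ℂ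

/-- The density matrices on `n` qubits: positive semidefinite operators of trace one. -/
def IsQuantumState {n : ℕ} (ρ : QubitOp n) : Prop :=
  ρ.PosSemidef ∧ ρ.trace = 1

/-- The operator `A ⊗ I` that acts as `A` on the qubits in `S` and as the identity on all other
qubits. -/
noncomputable def actOn {n : ℕ} (S : Finset (Fin n)) (A : Matrix (S → Fin 2) (S → Fin 2) ℂ) :
    QubitOp n :=
  open Classical in
  Matrix.of fun x y =>
    if ∀ l, l ∉ S → x l = y l then A (fun l => x l) (fun l => y l) else 0

/-- An operator is `k`-local if it acts nontrivially on at most `k` qubits. -/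
def IsKLocal {n : ℕ} (k : ℕ) (O : QubitOp n) : Prop :=
  ∃ S : Finset (Fin n), S.card ≤ k ∧
    ∃ A : Matrix (S → Fin 2) (S → Fin 2) ℂ, O = actOn S A

/-- A `k`-local observable `O` with `-I ⪯ O ⪯ I`. (Hermiticity is part of `PosSemidef`.) -/
def IsBoundedLocalObservable {n : ℕ} (k : ℕ) (O : QubitOp n) : Prop :=
  IsKLocal k O ∧ (1 + O).PosSemidef ∧ (1 - O).PosSemidef

/-- The product vector `v₁ ⊗ ⋯ ⊗ vₙ` of single-qubit vectors. -/
noncomputable def productVec {n : ℕ} (v : Fin n → EuclideanSpace ℂ (Fin 2)) :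
    (Fin n → Fin 2) → ℂ :=
  fun x => ∏ l, v l (x l)

/-- The operator `w 2ⁿ |v⟩⟨v|` for the product vector `v = v₁ ⊗ ⋯ ⊗ vₙ`. -/
noncomputable def productEffect {n : ℕ} (w : ℝ) (v : Fin n → EuclideanSpace ℂ (Fin 2)) :
    QubitOp n :=
  ((w : ℂ) * 2 ^ n) • vecMulVec (productVec v) (star (productVec v))

/-- A local measurement on `n` qubits: a POVM with finitely many outcomes `i` and effects
`wᵢ 2ⁿ |vᵢ⟩⟨vᵢ|`, where `vᵢ` is a tensor product of `n` single-qubit unit vectors.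
The normalization `∑ i, wᵢ = 1` is the trace of `sum_effect`, see `LocalMeasurement.sum_weight`. -/
structure LocalMeasurement (n : ℕ) where
  numOutcomes : ℕ
  weight : Fin numOutcomes → ℝ
  vec : Fin numOutcomes → Fin n → EuclideanSpace ℂ (Fin 2)
  weight_nonneg : ∀ i, 0 ≤ weight i
  norm_vec : ∀ i l, ‖vec i l‖ = 1
  sum_effect : ∑ i, productEffect (weight i) (vec i) = 1

/-- The POVM element of outcome `i`. -/
noncomputable def LocalMeasurement.effect {n : ℕ} (F : LocalMeasurement n)
    (i : Fin F.numOutcomes) : QubitOp n :=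
  productEffect (F.weight i) (F.vec i)

/-- Born's rule for the sequence of single-copy measurements `F₁, …, F_N`: the probability of the
outcome string `y` when `F_j` is performed on the `j`-th copy of `ρ`. -/
noncomputable def outcomeProb {n N : ℕ} (F : Fin N → LocalMeasurement n) (ρ : QubitOp n)
    (y : ∀ j, Fin (F j).numOutcomes) : ℝ :=
  ∏ j, ((F j).effect (y j) * ρ).trace.re

/-- The tuples of predictions that are `ε`-accurate for all the values `Tr (O i * ρ)` at once. -/
def accuratePredictions {n M : ℕ} (ε : ℝ) (O : Fin M → QubitOp n) (ρ : QubitOp n) :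
    Set (Fin M → ℝ) :=
  {o | ∀ i, |o i - (O i * ρ).trace.re| ≤ ε}

/-- There is a machine, possibly randomized, which from the outcome string `y` alone produces
predictions (with law `machine y`) and which, for every unknown state `ρ`, is `ε`-accurate for all
of `O₁, …, O_M` with probability at least `p` (over the measurement outcomes and its own
randomness). -/
def CanPredict {n N M : ℕ} (F : Fin N → LocalMeasurement n) (O : Fin M → QubitOp n)
    (ε p : ℝ) : Prop :=
  ∃ machine : (∀ j, Fin (F j).numOutcomes) → MeasureTheory.Measure (Fin M → ℝ),
    (∀ y, MeasureTheory.IsProbabilityMeasure (machine y)) ∧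
    ∀ ρ : QubitOp n, IsQuantumState ρ →
      p ≤ ∑ y, outcomeProb F ρ y * (machine y).real (accuratePredictions ε O ρ)

theorem trace_productEffect {n : ℕ} (w : ℝ) (v : Fin n → EuclideanSpace ℂ (Fin 2))
    (hv : ∀ l, ‖v l‖ = 1) : (productEffect w v).trace = w * 2 ^ n := by
  have h : ∀ l, ∑ b, v l b * star (v l b) = 1 := by
    intro l
    have h1 : ‖v l‖ ^ 2 = 1 := by rw [hv l]; norm_num
    rw [EuclideanSpace.norm_sq_eq] at h1
    have h2 : ∀ b, v l b * star (v l b) = ((‖v l b‖ ^ 2 : ℝ) : ℂ) := by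
      intro b
      have := RCLike.mul_conj (v l b)
      simpa using this
    simp only [h2]
    rw [← Complex.ofReal_sum, h1, Complex.ofReal_one]
  have h3 : productVec v ⬝ᵥ star (productVec v) = 1 := by
    simp only [dotProduct, productVec, Pi.star_apply, star_prod, ← Finset.prod_mul_distrib]
    rw [← Fintype.prod_sum (fun l b => v l b * star (v l b))]
    simp only [h, Finset.prod_const_one]
  rw [productEffect, trace_smul, trace_vecMulVec, h3, smul_eq_mul, mul_one]

theorem LocalMeasurement.sum_weight {n : ℕ} (F : LocalMeasurement n) : ∑ i, F.weight i = 1 := by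
  have h := congrArg Matrix.trace F.sum_effect
  rw [trace_sum, trace_one] at h
  simp only [trace_productEffect _ _ (F.norm_vec _), ← Finset.sum_mul] at h
  have h2 : ((2 : ℂ) ^ n) ≠ 0 := pow_ne_zero n two_ne_zero
  have h3 : (∑ i, (F.weight i : ℂ)) = 1 := by
    apply mul_right_cancel₀ h2
    rw [h]; simp
  exact_mod_cast h3

/-! Take `M` Pauli strings `P_a` of weight `k` and the states `2^{-n}(1 + δ P_a)` with `δ` slightly
above `2ε`. Distinct strings are trace-orthogonal, so accuracy at different `a` means disjoint
events (`disjoint_accuratePredictions`). Hence, under the outcome law `∏ w` of the maximally mixed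
state, the probabilities of these events add up to at most one.

A change of measure (`mul_sum_tilted_le`) bounds the cost of raising each of them to `p` by the
relative entropy between the outcome laws, which is at most the sum over copies of `∑ w (δ⟨P_a⟩)^2`.
For one fixed family of strings this may be large. But the measurements are fixed before the
observables, so the labels `X, Y, Z` may be permuted cyclically on each qubit. Bloch vectors of pure
states have length one, so averaging over the shifts replaces `⟨P_a⟩^2` by exactly `3^{-k}`
(`sum_sq_pauliStringExp_shiftLabels`).

This gives `M b p ≤ M N δ^2 / 3^k + e^b - 1` for every `b ≥ 0`. With `b = θ log M` and `θ` small,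
the last term is at most a fraction `2^{θ-1}/p < 1` of the left side, which leaves the bound on `N`.
-/

/-! ### Tensor products of single-qubit operators -/

/-- The operator `A₁ ⊗ ⋯ ⊗ Aₙ`. -/
def tensorOp {n : ℕ} (A : Fin n → Matrix (Fin 2) (Fin 2) ℂ) : QubitOp n :=
  Matrix.of fun x y => ∏ l, A l (x l) (y l)

theorem tensorOp_mul {n : ℕ} (A B : Fin n → Matrix (Fin 2) (Fin 2) ℂ) :
    tensorOp A * tensorOp B = tensorOp fun l => A l * B l := by
  ext x y
  simp only [tensorOp, mul_apply, of_apply, ← Finset.prod_mul_distrib]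
  rw [← Fintype.prod_sum (fun l b => A l (x l) b * B l b (y l))]

theorem trace_tensorOp {n : ℕ} (A : Fin n → Matrix (Fin 2) (Fin 2) ℂ) :
    (tensorOp A).trace = ∏ l, (A l).trace := by
  simp only [tensorOp, trace, diag_apply, of_apply]
  rw [← Fintype.prod_sum (fun l b => A l b b)]

theorem tensorOp_one {n : ℕ} : tensorOp (fun _ : Fin n => 1) = 1 := by
  ext x y
  simp only [tensorOp, of_apply, one_apply, Finset.prod_ite_zero, Finset.prod_const_one,
    Finset.mem_univ, true_imp_iff, funext_iff]

theorem conjTranspose_tensorOp {n : ℕ} (A : Fin n → Matrix (Fin 2) (Fin 2) ℂ) :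
    (tensorOp A)ᴴ = tensorOp fun l => (A l)ᴴ := by
  ext x y
  simp [tensorOp, conjTranspose_apply]

theorem vecMulVec_productVec {n : ℕ} (v : Fin n → EuclideanSpace ℂ (Fin 2)) :
    vecMulVec (productVec v) (star (productVec v)) =
      tensorOp fun l => vecMulVec (v l) (star (v l : Fin 2 → ℂ)) := by
  ext x y
  simp [tensorOp, productVec, vecMulVec_apply, Finset.prod_mul_distrib]

/-! ### Pauli strings -/

/-- The single-qubit Pauli operators, `none` labelling the identity. -/
noncomputable def pauli : Option (Fin 3) → Matrix (Fin 2) (Fin 2) ℂ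
  | none => 1
  | some 0 => !![0, 1; 1, 0]
  | some 1 => !![0, -Complex.I; Complex.I, 0]
  | some 2 => !![1, 0; 0, -1]

theorem pauli_mul_self (q : Option (Fin 3)) : pauli q * pauli q = 1 := by
  rcases q with _ | q
  · simp [pauli]
  · fin_cases q <;> simp [pauli, one_fin_two]

theorem conjTranspose_pauli (q : Option (Fin 3)) : (pauli q)ᴴ = pauli q := by
  rcases q with _ | q
  · simp [pauli]
  · fin_cases q <;> ext i j <;> fin_cases i <;> fin_cases j <;> simp [pauli]

theorem trace_pauli_mul_of_ne {q r : Option (Fin 3)} (h : q ≠ r) :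
    (pauli q * pauli r).trace = 0 := by
  rcases q with _ | q <;> rcases r with _ | r
  · exact absurd rfl h
  · fin_cases r <;> simp [pauli, trace_fin_two]
  · fin_cases q <;> simp [pauli, trace_fin_two]
  · fin_cases q <;> fin_cases r <;> first | exact absurd rfl h | simp [pauli, trace_fin_two]

/-- The Pauli string with label `g l` on qubit `l`. -/
noncomputable def pauliString {n : ℕ} (g : Fin n → Option (Fin 3)) : QubitOp n :=
  tensorOp fun l => pauli (g l)

theorem pauliString_mul_self {n : ℕ} (g : Fin n → Option (Fin 3)) :
    pauliString g * pauliString g = 1 := by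
  simp only [pauliString, tensorOp_mul, pauli_mul_self, tensorOp_one]

theorem conjTranspose_pauliString {n : ℕ} (g : Fin n → Option (Fin 3)) :
    (pauliString g)ᴴ = pauliString g := by
  simp only [pauliString, conjTranspose_tensorOp, conjTranspose_pauli]

theorem pauliString_none {n : ℕ} : pauliString (fun _ : Fin n => none) = 1 :=
  tensorOp_one

theorem trace_pauliString_mul {n : ℕ} (g h : Fin n → Option (Fin 3)) :
    (pauliString g * pauliString h).trace = if g = h then 2 ^ n else 0 := by
  split_ifs with hgh
  · rw [hgh, pauliString_mul_self, trace_one]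
    simp
  · obtain ⟨l, hl⟩ := Function.ne_iff.mp hgh
    rw [pauliString, pauliString, tensorOp_mul, trace_tensorOp]
    exact Finset.prod_eq_zero (Finset.mem_univ l) (trace_pauli_mul_of_ne hl)

theorem trace_pauliString {n : ℕ} {g : Fin n → Option (Fin 3)} (hg : g ≠ fun _ => none) :
    (pauliString g).trace = 0 := by
  rw [← mul_one (pauliString g), ← pauliString_none, trace_pauliString_mul, if_neg hg]

/-- `(1 + P)^2 = 2(1 + P)`, so `1 + P` is half a square of a Hermitian matrix. -/
theorem posSemidef_one_add_of_involution {ι : Type*} [Fintype ι] [DecidableEq ι]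
    {P : Matrix ι ι ℂ} (hP : Pᴴ = P) (hPP : P * P = 1) : (1 + P).PosSemidef := by
  have h : 1 + P = (1 / 2 : ℝ) • ((1 + P)ᴴ * (1 + P)) := by
    rw [conjTranspose_add, conjTranspose_one, hP, add_mul, mul_add, mul_add, hPP, one_mul, one_mul,
      mul_one]
    module
  rw [h]
  exact (posSemidef_conjTranspose_mul_self _).smul (by norm_num)

theorem posSemidef_one_add_pauliString {n : ℕ} (g : Fin n → Option (Fin 3)) :
    (1 + pauliString g).PosSemidef :=
  posSemidef_one_add_of_involution (conjTranspose_pauliString g) (pauliString_mul_self g)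

theorem posSemidef_one_sub_pauliString {n : ℕ} (g : Fin n → Option (Fin 3)) :
    (1 - pauliString g).PosSemidef := by
  rw [sub_eq_add_neg]
  apply posSemidef_one_add_of_involution
  · rw [conjTranspose_neg, conjTranspose_pauliString]
  · rw [neg_mul_neg, pauliString_mul_self]

/-- The qubits on which a Pauli string acts nontrivially. -/
def pauliSupport {n : ℕ} (g : Fin n → Option (Fin 3)) : Finset (Fin n) :=
  {l | g l ≠ none}

theorem isKLocal_pauliString {n k : ℕ} {g : Fin n → Option (Fin 3)}
    (hg : (pauliSupport g).card ≤ k) : IsKLocal k (pauliString g) := by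
  refine ⟨pauliSupport g, hg, Matrix.of fun x y => ∏ l : pauliSupport g, pauli (g l) (x l) (y l), ?_⟩
  have hnone : ∀ l, l ∉ pauliSupport g → g l = none := by
    intro l hl
    simpa [pauliSupport] using hl
  ext x y
  simp only [pauliString, tensorOp, actOn, of_apply]
  split_ifs with h
  · rw [Finset.prod_coe_sort (pauliSupport g) fun l => pauli (g l) (x l) (y l)]
    refine (Finset.prod_subset (Finset.subset_univ _) fun l _ hl => ?_).symm
    rw [hnone l hl, h l hl]
    simp [pauli]
  · push Not at h
    obtain ⟨l, hl, hxy⟩ := h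
    refine Finset.prod_eq_zero (Finset.mem_univ l) ?_
    rw [hnone l hl]
    simp [pauli, hxy]

theorem isBoundedLocalObservable_pauliString {n k : ℕ} {g : Fin n → Option (Fin 3)}
    (hg : (pauliSupport g).card ≤ k) : IsBoundedLocalObservable k (pauliString g) :=
  ⟨isKLocal_pauliString hg, posSemidef_one_add_pauliString g, posSemidef_one_sub_pauliString g⟩

/-- There are at least `3 ^ k * n.choose k` Pauli strings of weight `k`. -/
theorem exists_pauliLabels {n k M : ℕ} (hM : M ≤ 3 ^ k * n.choose k) :
    ∃ g : Fin M → Fin n → Option (Fin 3),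
      Function.Injective g ∧ ∀ a, (pauliSupport (g a)).card = k := by
  classical
  let T := Σ S : Finset.powersetCard k (Finset.univ : Finset (Fin n)), (S.1 → Fin 3)
  have hcard : Fintype.card T = 3 ^ k * n.choose k := by
    have h : ∀ S : Finset.powersetCard k (Finset.univ : Finset (Fin n)),
        Fintype.card (S.1 → Fin 3) = 3 ^ k := by
      intro S
      simp [(Finset.mem_powersetCard.mp S.2).2]
    rw [Fintype.card_sigma, Finset.sum_congr rfl fun S _ => h S]
    simp [mul_comm]
  obtain ⟨e⟩ : Nonempty (Fin M ↪ T) :=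
    Function.Embedding.nonempty_of_card_le (by rw [hcard, Fintype.card_fin]; exact hM)
  let G : T → Fin n → Option (Fin 3) := fun t l =>
    if h : l ∈ t.1.1 then some (t.2 ⟨l, h⟩) else none
  have hsupp : ∀ t, pauliSupport (G t) = t.1.1 := by
    intro t
    ext l
    simp [pauliSupport, G]
  have hinj : Function.Injective G := by
    rintro ⟨S, f⟩ ⟨S', f'⟩ h
    obtain rfl : S = S' := Subtype.ext (by rw [← hsupp ⟨S, f⟩, h, hsupp])
    congr 1
    ext1 ⟨l, hl⟩
    have := congrFun h l
    simpa [G, hl] using this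
  refine ⟨fun a => G (e a), hinj.comp e.injective, fun a => ?_⟩
  rw [hsupp]
  exact (Finset.mem_powersetCard.mp (e a).1.2).2

/-- Cyclic permutation of `X`, `Y`, `Z` by `s l` on each qubit `l`. -/
def shiftLabels {n : ℕ} (s : Fin n → Fin 3) (g : Fin n → Option (Fin 3)) :
    Fin n → Option (Fin 3) :=
  fun l => (g l).map (· + s l)

theorem shiftLabels_injective {n : ℕ} (s : Fin n → Fin 3) :
    Function.Injective (shiftLabels s) := by
  intro g h hgh
  ext1 l
  exact Option.map_injective (add_left_injective (s l)) (congrFun hgh l)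

theorem pauliSupport_shiftLabels {n : ℕ} (s : Fin n → Fin 3) (g : Fin n → Option (Fin 3)) :
    pauliSupport (shiftLabels s g) = pauliSupport g := by
  simp [pauliSupport, shiftLabels]

/-! ### Pauli expectation values of product vectors -/

/-- The expectation value of a Pauli operator in the vector `v`. -/
noncomputable def pauliExp (v : EuclideanSpace ℂ (Fin 2)) (q : Option (Fin 3)) : ℝ :=
  (vecMulVec (v : Fin 2 → ℂ) (star (v : Fin 2 → ℂ)) * pauli q).trace.re

theorem trace_vecMulVec_mul_pauli (v : EuclideanSpace ℂ (Fin 2)) (q : Option (Fin 3)) :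
    (vecMulVec (v : Fin 2 → ℂ) (star (v : Fin 2 → ℂ)) * pauli q).trace = pauliExp v q := by
  refine (Complex.conj_eq_iff_re.mp ?_).symm
  rw [starRingEnd_apply, ← trace_conjTranspose, conjTranspose_mul, conjTranspose_pauli,
    conjTranspose_vecMulVec, star_star, trace_mul_comm]

theorem normSq_add_normSq_of_norm_eq_one {v : EuclideanSpace ℂ (Fin 2)} (hv : ‖v‖ = 1) :
    (v 0).re ^ 2 + (v 0).im ^ 2 + (v 1).re ^ 2 + (v 1).im ^ 2 = 1 := by
  have h : ‖v‖ ^ 2 = 1 := by rw [hv, one_pow]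
  rw [EuclideanSpace.norm_sq_eq, Fin.sum_univ_two, Complex.sq_norm, Complex.sq_norm,
    Complex.normSq_apply, Complex.normSq_apply] at h
  linarith

theorem pauliExp_none {v : EuclideanSpace ℂ (Fin 2)} (hv : ‖v‖ = 1) : pauliExp v none = 1 := by
  have h := normSq_add_normSq_of_norm_eq_one hv
  simp [pauliExp, pauli]
  linarith

/-- The Bloch vector of a pure qubit state has length one. -/
theorem sum_sq_pauliExp {v : EuclideanSpace ℂ (Fin 2)} (hv : ‖v‖ = 1) :
    ∑ c, pauliExp v (some c) ^ 2 = 1 := by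
  have h := normSq_add_normSq_of_norm_eq_one hv
  rw [Fin.sum_univ_three]
  simp [pauliExp, pauli, trace_fin_two, vecMulVec_apply, mul_apply, Fin.sum_univ_two]
  -- With `S = |v 0|^2 + |v 1|^2`, the squared Bloch length is `S^2`, and `S^2 - 1 = (S + 1)(S -
  -- 1)`.
  linear_combination
    ((v 0).re ^ 2 + (v 0).im ^ 2 + (v 1).re ^ 2 + (v 1).im ^ 2 + 1) * h

theorem abs_pauliExp_le_one {v : EuclideanSpace ℂ (Fin 2)} (hv : ‖v‖ = 1) (q : Option (Fin 3)) :
    |pauliExp v q| ≤ 1 := by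
  rcases q with _ | q
  · rw [pauliExp_none hv, abs_one]
  · rw [← sq_le_one_iff_abs_le_one, ← sum_sq_pauliExp hv]
    exact Finset.single_le_sum (f := fun c => pauliExp v (some c) ^ 2)
      (fun c _ => sq_nonneg _) (Finset.mem_univ q)

/-- The expectation value of a Pauli string in a product vector. -/
noncomputable def pauliStringExp {n : ℕ} (v : Fin n → EuclideanSpace ℂ (Fin 2))
    (g : Fin n → Option (Fin 3)) : ℝ :=
  ∏ l, pauliExp (v l) (g l)

theorem abs_pauliStringExp_le_one {n : ℕ} {v : Fin n → EuclideanSpace ℂ (Fin 2)}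
    (hv : ∀ l, ‖v l‖ = 1) (g : Fin n → Option (Fin 3)) : |pauliStringExp v g| ≤ 1 := by
  rw [pauliStringExp, Finset.abs_prod]
  exact Finset.prod_le_one (fun _ _ => abs_nonneg _) fun l _ => abs_pauliExp_le_one (hv l) _

/-- Summed over all cyclic shifts of the labels, the squared expectation values of a Pauli string
amount to one third per qubit of its support. -/
theorem sum_sq_pauliStringExp_shiftLabels {n : ℕ} {v : Fin n → EuclideanSpace ℂ (Fin 2)}
    (hv : ∀ l, ‖v l‖ = 1) (g : Fin n → Option (Fin 3)) :
    3 ^ (pauliSupport g).card * ∑ s, pauliStringExp v (shiftLabels s g) ^ 2 = (3 : ℝ) ^ n := by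
  have h : ∀ l, (if g l ≠ none then (3 : ℝ) else 1) *
      ∑ c, pauliExp (v l) ((g l).map (· + c)) ^ 2 = 3 := by
    intro l
    rcases hl : g l with _ | q
    · simp [pauliExp_none (hv l)]
    · have := Equiv.sum_comp (Equiv.addLeft q) fun c => pauliExp (v l) (some c) ^ 2
      simp only [Equiv.coe_addLeft] at this
      simp [this, sum_sq_pauliExp (hv l)]
  simp only [pauliStringExp, shiftLabels, ← Finset.prod_pow]
  rw [← Fintype.prod_sum (fun l c => pauliExp (v l) ((g l).map (· + c)) ^ 2)]
  have h2 : (3 : ℝ) ^ (pauliSupport g).card = ∏ l, if g l ≠ none then (3 : ℝ) else 1 := by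
    rw [← Finset.prod_filter, Finset.prod_const, pauliSupport]
  rw [h2, ← Finset.prod_mul_distrib, Finset.prod_congr rfl fun l _ => h l]
  simp

theorem trace_productEffect_mul_pauliString {n : ℕ} (w : ℝ)
    (v : Fin n → EuclideanSpace ℂ (Fin 2)) (g : Fin n → Option (Fin 3)) :
    (productEffect w v * pauliString g).trace = w * 2 ^ n * pauliStringExp v g := by
  rw [productEffect, smul_mul_assoc, trace_smul, vecMulVec_productVec, pauliString, tensorOp_mul,
    trace_tensorOp, smul_eq_mul, Finset.prod_congr rfl fun l _ => trace_vecMulVec_mul_pauli _ _,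
    pauliStringExp, Complex.ofReal_prod]

/-- The effects sum to the identity and the Pauli string is traceless. This makes the perturbation
of the outcome law centred. -/
theorem LocalMeasurement.sum_weight_mul_pauliStringExp {n : ℕ} (F : LocalMeasurement n)
    {g : Fin n → Option (Fin 3)} (hg : g ≠ fun _ => none) :
    ∑ i, F.weight i * pauliStringExp (F.vec i) g = 0 := by
  have h : ∑ i, (productEffect (F.weight i) (F.vec i) * pauliString g).trace = 0 := by
    rw [← trace_sum, ← Finset.sum_mul, F.sum_effect, one_mul, trace_pauliString hg]
  simp only [trace_productEffect_mul_pauliString, mul_right_comm _ ((2 : ℂ) ^ n),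
    ← Finset.sum_mul] at h
  have h2 := (mul_eq_zero.mp h).resolve_right (pow_ne_zero n two_ne_zero)
  exact_mod_cast h2

/-! ### The perturbed maximally mixed states -/

/-- The maximally mixed state, perturbed by `δ` times a Pauli string. -/
noncomputable def pauliState {n : ℕ} (δ : ℝ) (g : Fin n → Option (Fin 3)) : QubitOp n :=
  ((2 : ℝ) ^ n)⁻¹ • (1 + δ • pauliString g)

theorem isQuantumState_pauliState {n : ℕ} {δ : ℝ} (h0 : 0 ≤ δ) (h1 : δ ≤ 1)
    {g : Fin n → Option (Fin 3)} (hg : g ≠ fun _ => none) : IsQuantumState (pauliState δ g) := by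
  constructor
  · have h : 1 + δ • pauliString g = (1 - δ) • 1 + δ • (1 + pauliString g) := by module
    rw [pauliState, h]
    exact ((PosSemidef.one.smul (sub_nonneg.mpr h1)).add
      ((posSemidef_one_add_pauliString g).smul h0)).smul (by positivity)
  · rw [pauliState, trace_smul, trace_add, trace_smul, trace_pauliString hg, trace_one]
    simp

theorem trace_pauliString_mul_pauliState {n : ℕ} (δ : ℝ) {g h : Fin n → Option (Fin 3)}
    (hh : h ≠ fun _ => none) :
    (pauliString h * pauliState δ g).trace.re = if h = g then δ else 0 := by
  rw [pauliState, mul_smul_comm, trace_smul, mul_add, mul_one, mul_smul_comm, trace_add,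
    trace_smul, trace_pauliString hh, trace_pauliString_mul]
  split_ifs
  · have : ((2 : ℂ) ^ n).re = 2 ^ n := by exact_mod_cast Complex.ofReal_re ((2 : ℝ) ^ n)
    rw [zero_add, Complex.smul_re, Complex.smul_re, this, smul_eq_mul, smul_eq_mul]
    field_simp
  · simp

theorem trace_effect_mul_pauliState {n : ℕ} (F : LocalMeasurement n) (i : Fin F.numOutcomes)
    (δ : ℝ) (g : Fin n → Option (Fin 3)) :
    (F.effect i * pauliState δ g).trace.re =
      F.weight i * (1 + δ * pauliStringExp (F.vec i) g) := by
  have h : (F.effect i * pauliState δ g).trace =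
      ((F.weight i * (1 + δ * pauliStringExp (F.vec i) g) : ℝ) : ℂ) := by
    rw [pauliState, mul_smul_comm, trace_smul, mul_add, mul_one, mul_smul_comm, trace_add,
      trace_smul, LocalMeasurement.effect, trace_productEffect _ _ (F.norm_vec i),
      trace_productEffect_mul_pauliString, Complex.real_smul, Complex.real_smul]
    push_cast
    field_simp
  rw [h, Complex.ofReal_re]

theorem outcomeProb_pauliState {n N : ℕ} (F : Fin N → LocalMeasurement n) (δ : ℝ)
    (g : Fin n → Option (Fin 3)) (y : ∀ j, Fin (F j).numOutcomes) :
    outcomeProb F (pauliState δ g) y =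
      ∏ j, (F j).weight (y j) * (1 + δ * pauliStringExp ((F j).vec (y j)) g) := by
  simp only [outcomeProb, trace_effect_mul_pauliState]

/-! ### Information-theoretic estimates -/

/-- Fenchel–Young inequality for the conjugate pair `exp` and `x log x - x`. -/
theorem mul_le_mul_log_sub_add_exp {x : ℝ} (hx : 0 ≤ x) (t : ℝ) :
    x * t ≤ x * Real.log x - x + Real.exp t := by
  rcases hx.eq_or_lt with rfl | hx
  · simpa using (Real.exp_pos t).le
  · have h := mul_le_mul_of_nonneg_left (Real.add_one_le_exp (t - Real.log x)) hx.le
    rw [Real.exp_sub, Real.exp_log hx, mul_div_cancel₀ _ hx.ne'] at h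
    linarith

/-- Convexity: `exp` lies below its chord from `0` to `b`. -/
theorem exp_mul_le_one_add {t : ℝ} (h0 : 0 ≤ t) (h1 : t ≤ 1) (b : ℝ) :
    Real.exp (b * t) ≤ 1 + t * (Real.exp b - 1) := by
  have h := convexOn_exp.2 (Set.mem_univ 0) (Set.mem_univ b) (sub_nonneg.mpr h1) h0 (by ring)
  simp only [smul_eq_mul, mul_zero, zero_add, Real.exp_zero] at h
  rw [mul_comm b t]
  linarith

/-- This is `log x ≤ x - 1` factor by factor; the prefactor makes vanishing factors harmless. It
turns relative entropy into `χ²`. -/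
theorem prod_mul_log_prod_le {ι : Type*} (s : Finset ι) {x : ι → ℝ} (hx : ∀ j ∈ s, 0 ≤ x j) :
    (∏ j ∈ s, x j) * Real.log (∏ j ∈ s, x j) ≤ (∏ j ∈ s, x j) * ∑ j ∈ s, (x j - 1) := by
  by_cases h : ∃ j ∈ s, x j = 0
  · rw [Finset.prod_eq_zero_iff.mpr h, zero_mul, zero_mul]
  · push Not at h
    refine mul_le_mul_of_nonneg_left ?_ (Finset.prod_nonneg hx)
    rw [Real.log_prod h]
    exact Finset.sum_le_sum fun j hj =>
      Real.log_le_sub_one_of_pos ((hx j hj).lt_of_ne (h j hj).symm)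

/-- Marginals of a product of finite probability distributions. -/
theorem sum_prod_mul_apply {N : ℕ} {κ : Fin N → Type*} [∀ j, Fintype (κ j)]
    (r : ∀ j, κ j → ℝ) (hr : ∀ j, ∑ i, r j i = 1) (j : Fin N) (u : κ j → ℝ) :
    ∑ y : ∀ j, κ j, (∏ l, r l (y l)) * u (y j) = ∑ i, r j i * u i := by
  classical
  -- Absorbing `u` into the `j`-th factor keeps the integrand a product, so the sum factorizes.
  let r' : ∀ l, κ l → ℝ := Function.update r j fun i => r j i * u i
  have h1 : ∀ y : ∀ j, κ j, (∏ l, r l (y l)) * u (y j) = ∏ l, r' l (y l) := by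
    intro y
    rw [← Finset.mul_prod_erase _ _ (Finset.mem_univ j),
      ← Finset.mul_prod_erase _ _ (Finset.mem_univ j),
      Finset.prod_congr rfl (g := fun l => r' l (y l))]
    · simp only [r', Function.update_self]
      ring
    · intro l hl
      simp only [r', Function.update_of_ne (Finset.ne_of_mem_erase hl)]
  rw [Finset.sum_congr rfl fun y _ => h1 y, ← Fintype.prod_sum,
    ← Finset.mul_prod_erase _ _ (Finset.mem_univ j), Finset.prod_eq_one, mul_one]
  · simp only [r', Function.update_self]
  · intro l hl
    simp only [r', Function.update_of_ne (Finset.ne_of_mem_erase hl), hr]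

/-- Change of measure for product distributions: a `[0, 1]`-valued test `m` that is large under the
tilted distribution `∏ w (1 + u)` and small under `∏ w` forces the relative entropy, and hence the
`χ²`-divergences, to be large. -/
theorem mul_sum_tilted_le {N : ℕ} {κ : Fin N → Type*} [∀ j, Fintype (κ j)]
    (w u : ∀ j, κ j → ℝ) (hw : ∀ j i, 0 ≤ w j i) (hw1 : ∀ j, ∑ i, w j i = 1)
    (hu : ∀ j i, 0 ≤ 1 + u j i) (hwu : ∀ j, ∑ i, w j i * u j i = 0)
    (m : (∀ j, κ j) → ℝ) (hm0 : ∀ y, 0 ≤ m y) (hm1 : ∀ y, m y ≤ 1) (b : ℝ) :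
    b * ∑ y, (∏ j, w j (y j) * (1 + u j (y j))) * m y ≤
      ∑ j, ∑ i, w j i * u j i ^ 2 + (Real.exp b - 1) * ∑ y, (∏ j, w j (y j)) * m y := by
  have hr : ∀ j, ∑ i, w j i * (1 + u j i) = 1 := by
    intro j
    simp only [mul_add, mul_one, Finset.sum_add_distrib, hw1, hwu, add_zero]
  have hpt : ∀ y : ∀ j, κ j, b * ((∏ j, w j (y j) * (1 + u j (y j))) * m y) ≤
      ∑ j, (∏ l, w l (y l) * (1 + u l (y l))) * u j (y j)
        - ∏ j, w j (y j) * (1 + u j (y j))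
        + (∏ j, w j (y j) + (Real.exp b - 1) * ((∏ j, w j (y j)) * m y)) := by
    intro y
    have hx : 0 ≤ ∏ j, (1 + u j (y j)) := Finset.prod_nonneg fun j _ => hu j _
    -- Here `x` is the likelihood ratio of the tilted law to `∏ w`.
    have h1 := mul_le_mul_log_sub_add_exp hx (b * m y)
    have h2 := exp_mul_le_one_add (hm0 y) (hm1 y) b
    have h3 := prod_mul_log_prod_le Finset.univ (fun j _ => hu j (y j))
    simp only [add_sub_cancel_left] at h3
    have h4 := mul_le_mul_of_nonneg_left
      (h1.trans (add_le_add (sub_le_sub_right h3 _) h2))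
      (Finset.prod_nonneg fun j (_ : j ∈ Finset.univ) => hw j (y j))
    rw [← Finset.mul_sum, Finset.prod_mul_distrib]
    linarith
  have hsum := Finset.sum_le_sum fun y (_ : y ∈ Finset.univ) => hpt y
  simp only [Finset.sum_add_distrib, Finset.sum_sub_distrib, ← Finset.mul_sum] at hsum
  have hP : ∑ y : ∀ j, κ j, ∏ j, w j (y j) * (1 + u j (y j)) = 1 := by
    rw [← Fintype.prod_sum fun j i => w j i * (1 + u j i)]
    exact Finset.prod_eq_one fun j _ => hr j
  have hQ : ∑ y : ∀ j, κ j, ∏ j, w j (y j) = 1 := by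
    rw [← Fintype.prod_sum fun j i => w j i]
    exact Finset.prod_eq_one fun j _ => hw1 j
  -- The tilted mean of `u j` is its `w j`-second moment, because its `w j`-mean vanishes.
  have hD : ∑ y : ∀ j, κ j, (∏ l, w l (y l) * (1 + u l (y l))) * ∑ j, u j (y j) =
      ∑ j, ∑ i, w j i * u j i ^ 2 := by
    simp only [Finset.mul_sum]
    rw [Finset.sum_comm]
    refine Finset.sum_congr rfl fun j _ => ?_
    rw [sum_prod_mul_apply (fun j i => w j i * (1 + u j i)) hr j (u j)]
    have : ∀ i, w j i * (1 + u j i) * u j i = w j i * u j i + w j i * u j i ^ 2 :=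
      fun i => by ring
    simp only [this, Finset.sum_add_distrib, hwu, zero_add]
  rw [hP, hQ, hD] at hsum
  linarith

/-! ### The lower bound -/

theorem measurableSet_accuratePredictions {n M : ℕ} (ε : ℝ) (O : Fin M → QubitOp n)
    (ρ : QubitOp n) : MeasurableSet (accuratePredictions ε O ρ) := by
  have h : accuratePredictions ε O ρ = ⋂ i, {o | |o i - (O i * ρ).trace.re| ≤ ε} := by
    ext o
    simp [accuratePredictions]
  rw [h]
  exact MeasurableSet.iInter fun i => measurableSet_le (by fun_prop) measurable_const

/-- Coordinate `a` would have to be within `ε` both of `δ` (state `a`) and of `0` (state `b`). -/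
theorem disjoint_accuratePredictions {n M : ℕ} {ε δ : ℝ} (hδ : 2 * ε < δ)
    {g : Fin M → Fin n → Option (Fin 3)} (hg : Function.Injective g)
    (hne : ∀ a, g a ≠ fun _ => none) :
    Pairwise (Function.onFun Disjoint fun a =>
      accuratePredictions ε (fun i => pauliString (g i)) (pauliState δ (g a))) := by
  intro a b hab
  refine Set.disjoint_left.mpr fun o ha hb => ?_
  have h1 := ha a
  have h2 := hb a
  rw [trace_pauliString_mul_pauliState δ (hne a), if_pos rfl] at h1
  rw [trace_pauliString_mul_pauliState δ (hne a), if_neg fun h => hab (hg h), sub_zero] at h2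
  have h3 := (abs_le.mp h1).1
  have h4 := (abs_le.mp h2).2
  linarith

/-- The estimate for a fixed family of Pauli strings. -/
theorem CanPredict.mul_le_of_pauliStrings {n N M : ℕ} {F : Fin N → LocalMeasurement n}
    {ε δ p b : ℝ} (hδ0 : 0 ≤ δ) (hδ1 : δ ≤ 1) (hδ : 2 * ε < δ) (hb : 0 ≤ b)
    {g : Fin M → Fin n → Option (Fin 3)} (hg : Function.Injective g)
    (hne : ∀ a, g a ≠ fun _ => none) (h : CanPredict F (fun a => pauliString (g a)) ε p) :
    M * (b * p) ≤
      ∑ a, ∑ j, ∑ i, (F j).weight i * (δ * pauliStringExp ((F j).vec i) (g a)) ^ 2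
        + (Real.exp b - 1) := by
  obtain ⟨machine, hprob, hacc⟩ := h
  let E : Fin M → Set (Fin M → ℝ) := fun a =>
    accuratePredictions ε (fun i => pauliString (g i)) (pauliState δ (g a))
  have hstep : ∀ a, b * p ≤
      ∑ j, ∑ i, (F j).weight i * (δ * pauliStringExp ((F j).vec i) (g a)) ^ 2
        + (Real.exp b - 1) * ∑ y : ∀ j, Fin (F j).numOutcomes,
          (∏ j, (F j).weight (y j)) * (machine y).real (E a) := by
    intro a
    have h1 := hacc _ (isQuantumState_pauliState hδ0 hδ1 (hne a))
    simp only [outcomeProb_pauliState] at h1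
    refine (mul_le_mul_of_nonneg_left h1 hb).trans ?_
    refine mul_sum_tilted_le (fun j => (F j).weight)
      (fun j i => δ * pauliStringExp ((F j).vec i) (g a)) (fun j => (F j).weight_nonneg)
      (fun j => (F j).sum_weight) (fun j i => ?_) (fun j => ?_) (fun y => (machine y).real (E a))
      (fun y => MeasureTheory.measureReal_nonneg) (fun y => ?_) b
    · have h2 : |δ * pauliStringExp ((F j).vec i) (g a)| ≤ 1 := by
        rw [abs_mul, abs_of_nonneg hδ0]
        exact mul_le_one₀ hδ1 (abs_nonneg _) (abs_pauliStringExp_le_one ((F j).norm_vec i) _)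
      linarith [(abs_le.mp h2).1]
    · simp only [mul_left_comm _ δ, ← Finset.mul_sum,
        (F j).sum_weight_mul_pauliStringExp (hne a), mul_zero]
    · have := hprob y
      exact MeasureTheory.measureReal_le_one
  have hQ : ∑ y : ∀ j, Fin (F j).numOutcomes, ∏ j, (F j).weight (y j) = 1 := by
    rw [← Fintype.prod_sum fun j i => (F j).weight i]
    exact Finset.prod_eq_one fun j _ => (F j).sum_weight
  have hE : ∀ y, ∑ a, (machine y).real (E a) ≤ 1 := by
    intro y
    have := hprob y
    rw [← MeasureTheory.measureReal_iUnion_fintype (disjoint_accuratePredictions hδ hg hne)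
      fun a => measurableSet_accuratePredictions _ _ _]
    exact MeasureTheory.measureReal_le_one
  have hq : ∑ a, ∑ y : ∀ j, Fin (F j).numOutcomes,
      (∏ j, (F j).weight (y j)) * (machine y).real (E a) ≤ 1 := by
    rw [Finset.sum_comm, ← hQ]
    refine Finset.sum_le_sum fun y _ => ?_
    rw [← Finset.mul_sum]
    exact mul_le_of_le_one_right
      (Finset.prod_nonneg fun j _ => (F j).weight_nonneg _) (hE y)
  have hsum := Finset.sum_le_sum fun a (_ : a ∈ Finset.univ) => hstep a
  rw [Finset.sum_add_distrib, Finset.sum_const, Finset.card_univ, Fintype.card_fin, nsmul_eq_mul,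
    ← Finset.mul_sum (Finset.univ : Finset (Fin M)) _ (Real.exp b - 1)] at hsum
  have hexp : 0 ≤ Real.exp b - 1 := sub_nonneg.mpr (Real.one_le_exp hb)
  linarith [mul_le_of_le_one_right hexp hq]

/-- The estimate averaged over all cyclic shifts of the Pauli labels. -/
theorem mul_le_of_forall_canPredict {n k M N : ℕ} {ε δ p b : ℝ} (hδ0 : 0 ≤ δ) (hδ1 : δ ≤ 1)
    (hδ : 2 * ε < δ) (hb : 0 ≤ b) (hk : k ≠ 0) (hM : M ≤ 3 ^ k * n.choose k)
    (F : Fin N → LocalMeasurement n)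
    (h : ∀ O : Fin M → QubitOp n, (∀ i, IsBoundedLocalObservable k (O i)) → CanPredict F O ε p) :
    M * (b * p) ≤ M * (N * δ ^ 2 / 3 ^ k) + (Real.exp b - 1) := by
  obtain ⟨g, hg, hcard⟩ := exists_pauliLabels hM
  have hne : ∀ s a, shiftLabels s (g a) ≠ fun _ => none := by
    intro s a h0
    apply hk
    rw [← hcard a, ← pauliSupport_shiftLabels s, h0]
    simp [pauliSupport]
  have hs : ∀ s : Fin n → Fin 3, M * (b * p) ≤
      ∑ a, ∑ j, ∑ i, (F j).weight i *
        (δ * pauliStringExp ((F j).vec i) (shiftLabels s (g a))) ^ 2 + (Real.exp b - 1) :=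
    fun s => (h _ fun a => isBoundedLocalObservable_pauliString
      (by rw [pauliSupport_shiftLabels, hcard])).mul_le_of_pauliStrings hδ0 hδ1 hδ hb
        ((shiftLabels_injective s).comp hg) (hne s)
  have hsum := Finset.sum_le_sum fun s (_ : s ∈ Finset.univ) => hs s
  have havg : ∑ s : Fin n → Fin 3, ∑ a, ∑ j, ∑ i, (F j).weight i *
      (δ * pauliStringExp ((F j).vec i) (shiftLabels s (g a))) ^ 2 =
        3 ^ n * (M * (N * δ ^ 2 / 3 ^ k)) := by
    have hi : ∀ a j i, ∑ s : Fin n → Fin 3, (F j).weight i *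
        (δ * pauliStringExp ((F j).vec i) (shiftLabels s (g a))) ^ 2 =
          (F j).weight i * (3 ^ n * (δ ^ 2 / 3 ^ k)) := by
      intro a j i
      have h1 := sum_sq_pauliStringExp_shiftLabels ((F j).norm_vec i) (g a)
      rw [hcard a] at h1
      simp only [mul_pow, ← Finset.mul_sum]
      rw [← h1]
      field_simp
    rw [Finset.sum_comm]
    have ha : ∀ a, ∑ s : Fin n → Fin 3, ∑ j, ∑ i, (F j).weight i *
        (δ * pauliStringExp ((F j).vec i) (shiftLabels s (g a))) ^ 2 =
          N * (3 ^ n * (δ ^ 2 / 3 ^ k)) := by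
      intro a
      rw [Finset.sum_comm]
      have hj : ∀ j, ∑ s : Fin n → Fin 3, ∑ i, (F j).weight i *
          (δ * pauliStringExp ((F j).vec i) (shiftLabels s (g a))) ^ 2 =
            3 ^ n * (δ ^ 2 / 3 ^ k) := by
        intro j
        rw [Finset.sum_comm, Finset.sum_congr rfl fun i _ => hi a j i, ← Finset.sum_mul,
          (F j).sum_weight, one_mul]
      simp only [hj, Finset.sum_const, Finset.card_univ, Fintype.card_fin, nsmul_eq_mul]
    simp only [ha, Finset.sum_const, Finset.card_univ, Fintype.card_fin, nsmul_eq_mul]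
    ring
  rw [Finset.sum_add_distrib, havg, Finset.sum_const, Finset.sum_const, Finset.card_univ,
    Fintype.card_fun, Fintype.card_fin, Fintype.card_fin, nsmul_eq_mul, nsmul_eq_mul] at hsum
  push_cast at hsum
  rw [← mul_add] at hsum
  exact le_of_mul_le_mul_left hsum (by positivity)

/-- Continuity at `θ = 0`, where the power equals `1/2`. This is where `p > 1/2` enters. -/
theorem exists_pos_two_rpow_sub_one_lt {p : ℝ} (hp : 1 / 2 < p) :
    ∃ θ : ℝ, 0 < θ ∧ θ ≤ 1 ∧ (2 : ℝ) ^ (θ - 1) < p := by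
  have hc : Continuous fun θ : ℝ => (2 : ℝ) ^ (θ - 1) :=
    Continuous.rpow continuous_const (by fun_prop) fun _ => Or.inl two_ne_zero
  have h0 : (2 : ℝ) ^ ((0 : ℝ) - 1) < p := by
    rw [zero_sub, Real.rpow_neg_one]
    linarith
  have h1 := (hc.continuousAt.eventually_lt continuousAt_const h0).filter_mono
    (nhdsWithin_le_nhds (s := Set.Ioi 0))
  obtain ⟨θ, h2, h3, h4⟩ := (h1.and (Ioc_mem_nhdsGT zero_lt_one)).exists
  exact ⟨θ, h3, h4, h2⟩

/-- Combines `e^s - 1 ≤ s e^s` at `s = θ log x` with the monotonicity of `x^{θ-1}`, which is largest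
at `x = 2`. -/
theorem exp_mul_log_sub_one_le {x θ : ℝ} (hx : 2 ≤ x) (h0 : 0 ≤ θ) (h1 : θ ≤ 1) :
    Real.exp (θ * Real.log x) - 1 ≤ x * (θ * Real.log x * 2 ^ (θ - 1)) := by
  have hx0 : 0 < x := by linarith
  have hlog : 0 ≤ Real.log x := Real.log_nonneg (by linarith)
  have h2 : Real.exp (θ * Real.log x) = x * x ^ (θ - 1) := by
    rw [mul_comm, ← Real.rpow_def_of_pos hx0, Real.rpow_sub_one hx0.ne', mul_div_cancel₀ _ hx0.ne']
  have h3 : x ^ (θ - 1) ≤ (2 : ℝ) ^ (θ - 1) :=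
    Real.rpow_le_rpow_of_nonpos two_pos hx (by linarith)
  have h4 : Real.exp (θ * Real.log x) - 1 ≤ Real.exp (θ * Real.log x) * (θ * Real.log x) := by
    have h5 := mul_le_mul_log_sub_add_exp (Real.exp_pos (θ * Real.log x)).le 0
    rw [Real.log_exp, mul_zero, Real.exp_zero] at h5
    linarith
  calc _ ≤ _ := h4
    _ = x * (θ * Real.log x * x ^ (θ - 1)) := by rw [h2]; ring
    _ ≤ _ := by gcongr

/-- Lower bound for predicting arbitrary `k`-local observables from a fixed sequence of local
single-copy measurements: for each success probability `p > 1/2` there is a constant `c > 0`, not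
depending on anything else, such that `N ≥ c · 3^k · log M / ε²`. -/
theorem mainTheorem3 (p : ℝ) (hp : 1 / 2 < p) :
    ∃ c : ℝ, 0 < c ∧
      ∀ (n k M N : ℕ) (ε : ℝ), 0 < ε → ε < 1 / 2 → M ≤ 3 ^ k * n.choose k →
        ∀ F : Fin N → LocalMeasurement n,
          (∀ O : Fin M → QubitOp n, (∀ i, IsBoundedLocalObservable k (O i)) →
            CanPredict F O ε p) →
          c * ((3 : ℝ) ^ k * Real.log M / ε ^ 2) ≤ (N : ℝ) := by
  obtain ⟨θ, hθ0, hθ1, hθp⟩ := exists_pos_two_rpow_sub_one_lt hp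
  have hgap : 0 < p - 2 ^ (θ - 1) := sub_pos.mpr hθp
  refine ⟨θ * (p - 2 ^ (θ - 1)) / 9, by positivity, ?_⟩
  intro n k M N ε hε hε2 hM F h
  rcases Nat.lt_or_ge M 2 with hM2 | hM2
  · have hlog : Real.log M = 0 := by interval_cases M <;> simp
    rw [hlog, mul_zero, zero_div, mul_zero]
    exact N.cast_nonneg
  have hk : k ≠ 0 := by
    rintro rfl
    rw [pow_zero, Nat.choose_zero_right] at hM
    omega
  have hMR : (2 : ℝ) ≤ M := by exact_mod_cast hM2
  have hlog : 0 ≤ Real.log M := Real.log_nonneg (by linarith)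
  -- The perturbation must exceed `2ε` for disjointness and stay at most `1` for positivity of the
  -- states; `ε < 1/2` allows both.
  have hδ : 2 * ε < min (3 * ε) 1 := lt_min (by linarith) (by linarith)
  have hδ0 : 0 ≤ min (3 * ε) 1 := by linarith
  have hδsq : min (3 * ε) 1 ^ 2 ≤ 9 * ε ^ 2 := by
    calc min (3 * ε) 1 ^ 2 ≤ (3 * ε) ^ 2 := pow_le_pow_left₀ hδ0 (min_le_left _ _) 2
      _ = 9 * ε ^ 2 := by ring
  have h1 := mul_le_of_forall_canPredict (b := θ * Real.log M) hδ0 (min_le_right _ _) hδ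
    (mul_nonneg hθ0.le hlog) hk hM F h
  have h2 := h1.trans (add_le_add_right (exp_mul_log_sub_one_le hMR hθ0.le hθ1) _)
  rw [← mul_add] at h2
  -- Both terms on the right now carry the factor `M`, which cancels.
  have h3 := le_of_mul_le_mul_left h2 (by linarith)
  have h4 : (N : ℝ) * min (3 * ε) 1 ^ 2 / 3 ^ k ≤ N * (9 * ε ^ 2) / 3 ^ k := by gcongr
  have h5 : θ * Real.log M * (p - 2 ^ (θ - 1)) ≤ N * (9 * ε ^ 2) / 3 ^ k := by linarith
  rw [le_div_iff₀ (by positivity)] at h5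
  rw [← mul_div_assoc, div_le_iff₀ (by positivity)]
  linarith
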